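/- Let $n\ge 0$ and $1\le k\le n+1$ be integers, let $e_1,\dots,e_{n+1}$ be the standard basis of $\mathbb R^{n+1}$ with its Euclidean norm, let $S=\{x\in\mathbb R^{n+1} : \sum_{j=1}^{n+1}x_j=1,\ x_j\ge 0 \text{ for all } j\}$ be the embedded regular $n$-simplex, and let $c=\frac1{n+1}\sum_{j=1}^{n+1} e_j$ be its centroid. For a linear subspace $H$ write $\operatorname{dist}(H,e_j)=\inf_{h\in H}\|h-e_j\|$, and let $\operatorname{vol}_{k-1}$ be the $(k-1)$-dimensional volume, i.e. the Lebesgue measure induced by the Euclidean structure on $(k-1)$-dimensional affine subspaces. Then the following hold. (1) For every $k$-dimensional linear subspace $H$ of $\mathbb R^{n+1}$ with $c\in H$, $$\operatorname{vol}_{k-1}(H\cap S)\le \frac{\sqrt{n+1}}{(k-1)!}\,\frac{(\sqrt k)^{\frac{k}{n+1}}}{\sqrt{n+1}}.$$ (2) If in addition $\operatorname{dist}(H,e_j)^2\le \frac{n+1-k}{n+2-k}$ for all $j=1,\dots,n+1$, then $$\operatorname{vol}_{k-1}(H\cap S)\le \frac{\sqrt{n+1}}{(k-1)!}\,\frac{1}{\sqrt{n+2-k}}.$$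 (3) The estimate in (2) is sharp: for all such $n$ and $k$ there is a $k$-dimensional linear subspace $H$ of $\mathbb R^{n+1}$ with $c\in H$ and $\operatorname{dist}(H,e_j)^2\le \frac{n+1-k}{n+2-k}$ for all $j$, for which equality holds in (2). -/

import Mathlib

open MeasureTheory

/-- The embedded regular `n`-simplex `{x ∈ ℝⁿ⁺¹ : x₁ + ⋯ + xₙ₊₁ = 1, xⱼ ≥ 0}`. -/
def regularSimplex (n : ℕ) : Set (EuclideanSpace ℝ (Fin (n + 1))) :=
  {x | ∑ j, x j = 1 ∧ ∀ j, 0 ≤ x j}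

/-- The centroid of the regular simplex: the barycentre of its vertices `e₁, …, eₙ₊₁`. -/
noncomputable def simplexCentroid (n : ℕ) : EuclideanSpace ℝ (Fin (n + 1)) :=
  Finset.univ.centroid ℝ fun j : Fin (n + 1) => EuclideanSpace.single j (1 : ℝ)

/-- The `d`-dimensional volume of a subset of a Euclidean space: the `d`-dimensional Hausdorff
measure, normalised so that on every `d`-dimensional affine subspace it is the Lebesgue measure
induced by the Euclidean structure. -/
noncomputable def kVol {m : ℕ} (d : ℕ) (A : Set (EuclideanSpace ℝ (Fin m))) : ENNReal :=
  (μHE[d] : Measure (EuclideanSpace ℝ (Fin m))) A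

/-! Let `J` embed `F` isometrically onto the subspace, and let `p j` be the projections of the
vertices; they form a Parseval frame of `F`. Since the subspace contains the centroid, it contains
the all-ones vector, so slicing the cone of nonnegative vectors by the coordinate sum turns the
volume of the section, up to the factor `(k-1)! / √(n+1)`, into the integral of `exp (-∑ ⟪p j, z⟫)`
over the cone (`kVol_section_mul_eq_lintegral`).

The geometric Brascamp–Lieb inequality, proved by transport to a Gaussian, bounds this integral by
`∏ ‖p j‖ ^ ‖p j‖²`, that is, by `exp (½ ∑ c j log (c j))` with `c j = ‖p j‖²`
(`lintegral_exp_neg_sum_inner_le_of_parseval`).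

What remains is to maximise a convex function of numbers `c j ≤ 1` with sum `k`. The centroid forces
`c j ≥ 1/(n+1)`, and the distance condition forces `c j ≥ 1/(n+2-k)`; these give the two bounds. For
sharpness, take the vectors that are constant on `n+2-k` chosen coordinates: the cone becomes an
orthant and its integral factorises. -/

open scoped RealInnerProductSpace

/-! ### Transport from the exponential law to the Gaussian -/

/-- The distribution function of the standard Gaussian is differentiable, with the Gaussian density
as its derivative. -/
theorem hasDerivAt_cdf_gaussianReal (s : ℝ) :
    HasDerivAt (ProbabilityTheory.cdf (ProbabilityTheory.gaussianReal 0 1))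
      ((√(2 * Real.pi))⁻¹ * Real.exp (-s ^ 2 / 2)) s := by
  set g : ℝ → ℝ := ProbabilityTheory.gaussianPDFReal 0 1 with hg
  have hgint : Integrable g := ProbabilityTheory.integrable_gaussianPDFReal 0 1
  have hgcont : Continuous g := by
    rw [hg, ProbabilityTheory.gaussianPDFReal_def]; fun_prop
  have hcdf : ∀ x, ProbabilityTheory.cdf (ProbabilityTheory.gaussianReal 0 1) x =
      ∫ y in Set.Iic x, g y := by
    intro x
    rw [ProbabilityTheory.cdf_eq_real, measureReal_def,
      ProbabilityTheory.gaussianReal_apply_eq_integral _ one_ne_zero,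
      ENNReal.toReal_ofReal]
    exact integral_nonneg fun y => ProbabilityTheory.gaussianPDFReal_nonneg _ _ _
  have heq : (fun x => ProbabilityTheory.cdf (ProbabilityTheory.gaussianReal 0 1) x) =
      fun x => (∫ y in Set.Iic (0 : ℝ), g y) + ∫ y in (0 : ℝ)..x, g y := by
    funext x
    rw [hcdf, ← intervalIntegral.integral_Iic_sub_Iic hgint.integrableOn hgint.integrableOn]
    ring
  have hd : HasDerivAt (fun x => (∫ y in Set.Iic (0 : ℝ), g y) + ∫ y in (0 : ℝ)..x, g y) (g s) s :=
    (intervalIntegral.integral_hasDerivAt_right hgint.intervalIntegrable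
      (hgcont.stronglyMeasurableAtFilter _ _) hgcont.continuousAt).const_add _
  rw [← heq] at hd
  convert! hd using 1
  simp [hg, ProbabilityTheory.gaussianPDFReal]

/-- The monotone map transporting the standard exponential distribution to the standard
Gaussian. -/
theorem exists_transport_exponential_gaussian :
    ∃ T : ℝ → ℝ, StrictMonoOn T (Set.Ioi 0) ∧
      ∀ t, 0 < t → HasDerivAt T (√(2 * Real.pi) * Real.exp (-t + T t ^ 2 / 2)) t := by
  set G : ℝ → ℝ := fun x => ProbabilityTheory.cdf (ProbabilityTheory.gaussianReal 0 1) x with hG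
  have hd : ∀ s, HasDerivAt G ((√(2 * Real.pi))⁻¹ * Real.exp (-s ^ 2 / 2)) s :=
    hasDerivAt_cdf_gaussianReal
  have hmono : StrictMono G := strictMono_of_deriv_pos fun s => by
    rw [(hd s).deriv]; positivity
  have hcont : Continuous G := continuous_iff_continuousAt.2 fun s => (hd s).continuousAt
  have hbot : Filter.Tendsto G Filter.atBot (nhds 0) := ProbabilityTheory.tendsto_cdf_atBot _
  have htop : Filter.Tendsto G Filter.atTop (nhds 1) := ProbabilityTheory.tendsto_cdf_atTop _
  have hlt : ∀ s, G s < 1 := fun s =>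
    (hmono (lt_add_one s)).trans_le (ProbabilityTheory.cdf_le_one _ _)
  have hpos : ∀ s, 0 < G s := fun s =>
    (ProbabilityTheory.cdf_nonneg _ _).trans_lt (hmono (sub_one_lt s))
  -- `T` is defined by equating the two distribution functions: `G (T t) = 1 - exp (-t)`.
  have hex : ∀ t : ℝ, 0 < t → ∃ s, G s = 1 - Real.exp (-t) := by
    intro t ht
    have h1 : 0 < 1 - Real.exp (-t) := by simpa using ht
    have h2 : 1 - Real.exp (-t) < 1 := by simpa using Real.exp_pos (-t)
    obtain ⟨a, ha⟩ := (hbot.eventually_lt_const h1).exists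
    obtain ⟨b, hb⟩ := (htop.eventually_const_lt h2).exists
    exact mem_range_of_exists_le_of_exists_ge hcont ⟨a, ha.le⟩ ⟨b, hb.le⟩
  choose! T hT using hex
  have hTmono : StrictMonoOn T (Set.Ioi 0) := by
    intro x hx y hy hxy
    rw [← hmono.lt_iff_lt, hT x hx, hT y hy]
    have := Real.exp_lt_exp.2 (neg_lt_neg hxy)
    linarith
  refine ⟨T, hTmono, fun t ht => ?_⟩
  -- A monotone map onto the whole line has no jumps; continuity of `T` is needed to differentiate
  -- it as a local inverse of `S`.
  have himg : T '' Set.Ioi 0 = Set.univ := by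
    refine Set.eq_univ_of_forall fun s => ?_
    have h1 : 0 < 1 - G s := by linarith [hlt s]
    have h3 : 0 < -Real.log (1 - G s) := by
      have := Real.log_neg h1 (by linarith [hpos s])
      linarith
    refine ⟨-Real.log (1 - G s), h3, hmono.injective ?_⟩
    rw [hT _ h3, neg_neg, Real.exp_log h1]
    ring
  have hTc : ContinuousAt T t :=
    hTmono.continuousAt_of_image_mem_nhds (Ioi_mem_nhds ht) (by rw [himg]; exact Filter.univ_mem)
  set S : ℝ → ℝ := fun s => -Real.log (1 - G s) with hS
  have h1 : 1 - G (T t) = Real.exp (-t) := by rw [hT t ht]; ring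
  have hSd : HasDerivAt S (-(-((√(2 * Real.pi))⁻¹ * Real.exp (-T t ^ 2 / 2)) / (1 - G (T t))))
      (T t) :=
    (((hd (T t)).const_sub 1).log (by rw [h1]; positivity)).neg
  have hinv : ∀ᶠ y in nhds t, S (T y) = y := by
    filter_upwards [Ioi_mem_nhds ht] with y hy
    simp only [hS]
    rw [hT y hy, sub_sub_cancel, Real.log_exp, neg_neg]
  have hne : -(-((√(2 * Real.pi))⁻¹ * Real.exp (-T t ^ 2 / 2)) / (1 - G (T t))) ≠ 0 := by
    rw [h1, neg_div, neg_neg]; positivity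
  convert! hSd.of_local_left_inverse hTc hne hinv using 1
  rw [h1, neg_div, neg_neg, inv_div, Real.exp_add, neg_div, Real.exp_neg (T t ^ 2 / 2)]
  field_simp

/-! ### Parseval frames and the Brascamp–Lieb inequality -/

section ParsevalFrame

variable {ι F : Type*} [Fintype ι] [NormedAddCommGroup F] [InnerProductSpace ℝ F]

/-- The synthesis operator of a Parseval frame is a contraction. -/
theorem norm_sq_sum_smul_le_of_parseval {p : ι → F}
    (hp : ∀ z, ∑ j, ⟪p j, z⟫ ^ 2 = ‖z‖ ^ 2) (y : ι → ℝ) :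
    ‖∑ j, y j • p j‖ ^ 2 ≤ ∑ j, y j ^ 2 := by
  set x := ∑ j, y j • p j with hx
  have h1 : ‖x‖ ^ 2 = ∑ j, y j * ⟪p j, x⟫ := by
    rw [← real_inner_self_eq_norm_sq]
    conv_lhs => rw [hx, sum_inner]
    simp only [real_inner_smul_left, ← hx]
  have h2 : ∑ j, y j * ⟪p j, x⟫ ≤ ∑ j, (y j ^ 2 / 2 + ⟪p j, x⟫ ^ 2 / 2) :=
    Finset.sum_le_sum fun j _ => by nlinarith [sq_nonneg (y j - ⟪p j, x⟫)]
  rw [Finset.sum_add_distrib, ← Finset.sum_div, ← Finset.sum_div, hp] at h2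
  linarith

/-- The squared norms of the vectors of a Parseval frame add up to the dimension. -/
theorem sum_norm_sq_eq_finrank_of_parseval [FiniteDimensional ℝ F] {p : ι → F}
    (hp : ∀ z, ∑ j, ⟪p j, z⟫ ^ 2 = ‖z‖ ^ 2) :
    ∑ j, ‖p j‖ ^ 2 = Module.finrank ℝ F := by
  have b := stdOrthonormalBasis ℝ F
  calc ∑ j, ‖p j‖ ^ 2 = ∑ j, ∑ i, ⟪p j, b i⟫ ^ 2 :=
        Finset.sum_congr rfl fun j _ => (b.sum_sq_inner_left (p j)).symm
    _ = ∑ i, ∑ j, ⟪p j, b i⟫ ^ 2 := Finset.sum_comm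
    _ = Module.finrank ℝ F := by simp [hp]

/-- The determinant inequality behind the geometric Brascamp–Lieb inequality. -/
theorem prod_rpow_le_det_of_parseval [FiniteDimensional ℝ F] {p : ι → F}
    (hp : ∀ z, ∑ j, ⟪p j, z⟫ ^ 2 = ‖z‖ ^ 2) {θ : ι → ℝ} (hθ : ∀ j, 0 < θ j) :
    ∏ j, θ j ^ (‖p j‖ ^ 2) ≤
      (∑ j, θ j • (innerSL ℝ (p j)).smulRight (p j) : F →L[ℝ] F).det := by
  set A : F →L[ℝ] F := ∑ j, θ j • (innerSL ℝ (p j)).smulRight (p j) with hA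
  have hAx : ∀ x y, ⟪A x, y⟫ = ∑ j, θ j * (⟪p j, x⟫ * ⟪p j, y⟫) := by
    intro x y
    simp [hA, sum_inner, real_inner_smul_left]
  have hsym : (A : F →ₗ[ℝ] F).IsSymmetric := by
    intro x y
    rw [real_inner_comm (_ : F) x]
    simp only [ContinuousLinearMap.coe_coe, hAx]
    exact Finset.sum_congr rfl fun j _ => by ring
  -- In an eigenbasis, each eigenvalue is a mean of the `θ j` with weights `⟪p j, b i⟫ ^ 2`. These
  -- sum to `1` over `j` (Parseval) and to `‖p j‖ ^ 2` over `i`, so weighted AM–GM for each `i`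
  -- gives the claim.
  set b := hsym.eigenvectorBasis rfl with hb
  set μ := hsym.eigenvalues rfl with hμ
  have hμeq : ∀ i, μ i = ∑ j, ⟪p j, b i⟫ ^ 2 * θ j := by
    intro i
    have h1 : A (b i) = μ i • b i := hsym.apply_eigenvectorBasis rfl i
    have h2 := hAx (b i) (b i)
    rw [h1, real_inner_smul_left, real_inner_self_eq_norm_sq, b.norm_eq_one] at h2
    rw [← mul_one (μ i), ← one_pow 2, h2]
    exact Finset.sum_congr rfl fun j _ => by ring
  have hdet : A.det = ∏ i, μ i := hsym.det_eq_prod_eigenvalues rfl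
  rw [hdet]
  calc ∏ j, θ j ^ (‖p j‖ ^ 2) = ∏ j, ∏ i, θ j ^ (⟪p j, b i⟫ ^ 2) := by
        refine Finset.prod_congr rfl fun j _ => ?_
        rw [← Real.rpow_sum_of_pos (hθ j), b.sum_sq_inner_left]
    _ = ∏ i, ∏ j, θ j ^ (⟪p j, b i⟫ ^ 2) := Finset.prod_comm
    _ ≤ ∏ i, μ i := by
        refine Finset.prod_le_prod
          (fun i _ => Finset.prod_nonneg fun j _ => Real.rpow_nonneg (hθ j).le _) fun i _ => ?_
        rw [hμeq]
        exact Real.geom_mean_le_arith_mean_weighted _ _ _ (fun j _ => sq_nonneg _)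
          (by rw [hp, b.norm_eq_one, one_pow]) fun j _ => (hθ j).le

variable [FiniteDimensional ℝ F] [MeasurableSpace F] [BorelSpace F]

theorem lintegral_exp_neg_half_norm_sq :
    ∫⁻ x : F, ENNReal.ofReal (Real.exp (-‖x‖ ^ 2 / 2)) =
      ENNReal.ofReal (√(2 * Real.pi) ^ Module.finrank ℝ F) := by
  have h := GaussianFourier.integral_rexp_neg_mul_sq_norm (V := F) (b := 1 / 2) (by norm_num)
  have hval : ∫ x : F, Real.exp (-‖x‖ ^ 2 / 2) = √(2 * Real.pi) ^ Module.finrank ℝ F := by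
    have : ∀ x : F, Real.exp (-‖x‖ ^ 2 / 2) = Real.exp (-(1 / 2) * ‖x‖ ^ 2) := fun x => by
      congr 1; ring
    simp_rw [this, h]
    rw [Real.sqrt_eq_rpow, ← Real.rpow_natCast, ← Real.rpow_mul (by positivity)]
    congr 1 <;> ring
  rw [← hval, ofReal_integral_eq_lintegral_ofReal]
  -- A nonintegrable function has Bochner integral `0`, so the nonzero value already gives
  -- integrability.
  · refine Integrable.of_integral_ne_zero ?_
    rw [hval]; positivity
  · exact Filter.Eventually.of_forall fun x => (Real.exp_pos _).le

/-- The rank one geometric Brascamp–Lieb inequality for exponential densities. -/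
theorem lintegral_exp_neg_sum_inner_le_of_parseval {p : ι → F}
    (hp : ∀ z, ∑ j, ⟪p j, z⟫ ^ 2 = ‖z‖ ^ 2) (hp0 : ∀ j, p j ≠ 0) :
    ∫⁻ z in {z | ∀ j, 0 < ⟪p j, z⟫}, ENNReal.ofReal (Real.exp (-∑ j, ⟪p j, z⟫)) ≤
      ENNReal.ofReal (∏ j, ‖p j‖ ^ (‖p j‖ ^ 2)) := by
  obtain ⟨T, hTmono, hTderiv⟩ := exists_transport_exponential_gaussian
  have hn : ∀ j, 0 < ‖p j‖ := fun j => norm_pos_iff.2 (hp0 j)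
  set U : Set F := {z | ∀ j, 0 < ⟪p j, z⟫} with hU
  have hUm : MeasurableSet U := by
    have : U = ⋂ j, {z | 0 < ⟪p j, z⟫} := by ext; simp [hU]
    rw [this]
    exact (isOpen_iInter_of_finite fun j =>
      isOpen_lt continuous_const (by fun_prop)).measurableSet
  -- With this scaling, `exp (-⟪p j, z⟫)` is the exponential density at `t j z` raised to the power
  -- `‖p j‖ ^ 2`.
  set t : ι → F → ℝ := fun j z => ⟪p j, z⟫ / ‖p j‖ ^ 2 with ht
  have htpos : ∀ z ∈ U, ∀ j, 0 < t j z := fun z hz j => div_pos (hz j) (pow_pos (hn j) 2)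
  set Φ : F → F := fun z => ∑ j, (‖p j‖ * T (t j z)) • p j with hΦ
  set θ : F → ι → ℝ := fun z j =>
    √(2 * Real.pi) * Real.exp (-t j z + T (t j z) ^ 2 / 2) / ‖p j‖ with hθ
  have hθpos : ∀ z j, 0 < θ z j := fun z j => by
    have := hn j
    simp only [hθ]; positivity
  set Φ' : F → F →L[ℝ] F := fun z => ∑ j, θ z j • (innerSL ℝ (p j)).smulRight (p j) with hΦ'
  have hderiv : ∀ z ∈ U, HasFDerivWithinAt Φ (Φ' z) U z := by
    intro z hz
    refine HasFDerivAt.hasFDerivWithinAt ?_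
    refine HasFDerivAt.fun_sum fun j _ => ?_
    have h1 : HasFDerivAt (t j) ((‖p j‖ ^ 2)⁻¹ • innerSL ℝ (p j)) z := by
      have := ((innerSL ℝ (p j)).hasFDerivAt (x := z)).const_mul (‖p j‖ ^ 2)⁻¹
      refine this.congr_of_eventuallyEq (Filter.Eventually.of_forall fun y => ?_)
      simp [ht, div_eq_inv_mul]
    have h2 := (((hTderiv (t j z) (htpos z hz j)).comp_hasFDerivAt z h1).const_mul
      ‖p j‖).smul_const (p j)
    refine h2.congr_fderiv ?_
    ext y
    have := (hn j).ne'
    simp only [hθ, ContinuousLinearMap.smulRight_apply, smul_apply,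
      smul_eq_mul, smul_smul]
    congr 1
    field_simp
  -- `Φ` is monotone: `⟪Φ x - Φ y, x - y⟫` is a sum of nonnegative terms, and if it vanishes then
  -- every `⟪p j, x - y⟫` does, whence `x = y` by Parseval.
  have hinj : Set.InjOn Φ U := by
    intro x hx y hy hxy
    by_contra hne
    have h0 : ⟪Φ x - Φ y, x - y⟫ = 0 := by rw [hxy, sub_self, inner_zero_left]
    have h1 : ⟪Φ x - Φ y, x - y⟫ =
        ∑ j, ‖p j‖ * ((T (t j x) - T (t j y)) * ⟪p j, x - y⟫) := by
      simp only [hΦ, ← Finset.sum_sub_distrib, ← sub_smul, sum_inner, real_inner_smul_left]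
      exact Finset.sum_congr rfl fun j _ => by ring
    have hterm : ∀ j, ⟪p j, x - y⟫ ≠ 0 →
        0 < ‖p j‖ * ((T (t j x) - T (t j y)) * ⟪p j, x - y⟫) := by
      intro j hj
      refine mul_pos (hn j) ?_
      rw [inner_sub_right] at hj ⊢
      rcases lt_or_gt_of_ne hj with h | h
      · refine mul_pos_of_neg_of_neg (sub_neg.2 (hTmono (htpos x hx j) (htpos y hy j) ?_)) h
        exact div_lt_div_of_pos_right (sub_neg.1 h) (pow_pos (hn j) 2)
      · refine mul_pos (sub_pos.2 (hTmono (htpos y hy j) (htpos x hx j) ?_)) h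
        exact div_lt_div_of_pos_right (sub_pos.1 h) (pow_pos (hn j) 2)
    have hnn : ∀ j ∈ Finset.univ,
        0 ≤ ‖p j‖ * ((T (t j x) - T (t j y)) * ⟪p j, x - y⟫) := by
      intro j _
      by_cases hj : ⟪p j, x - y⟫ = 0
      · rw [hj]; simp
      · exact (hterm j hj).le
    rw [h1, Finset.sum_eq_zero_iff_of_nonneg hnn] at h0
    have hz : ∀ j, ⟪p j, x - y⟫ = 0 := fun j => by
      by_contra hj
      exact (hterm j hj).ne' (h0 j (Finset.mem_univ j))
    have := hp (x - y)
    simp only [hz] at this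
    apply hne
    rw [← sub_eq_zero, ← norm_eq_zero]
    simpa using this.symm
  set K : ℝ := (∏ j, ‖p j‖ ^ (‖p j‖ ^ 2)) * (√(2 * Real.pi) ^ Module.finrank ℝ F)⁻¹ with hK
  have hK0 : 0 ≤ K := by
    refine mul_nonneg (Finset.prod_nonneg fun j _ => Real.rpow_nonneg (hn j).le _) ?_
    positivity
  have hpt : ∀ z ∈ U, Real.exp (-∑ j, ⟪p j, z⟫) ≤
      K * (|(Φ' z).det| * Real.exp (-‖Φ z‖ ^ 2 / 2)) := by
    intro z hz
    have hdet := prod_rpow_le_det_of_parseval hp (hθpos z)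
    have hnorm := norm_sq_sum_smul_le_of_parseval hp fun j => ‖p j‖ * T (t j z)
    -- The differential equation of `T`, solved for `exp (-t)` and raised to the power `‖p j‖ ^ 2`.
    -- In the product over `j`, the powers of `√(2π)` combine to the dimension.
    have hfac : ∀ j, Real.exp (-⟪p j, z⟫) = ‖p j‖ ^ (‖p j‖ ^ 2) *
        (√(2 * Real.pi) ^ (‖p j‖ ^ 2))⁻¹ * θ z j ^ (‖p j‖ ^ 2) *
        Real.exp (-(‖p j‖ * T (t j z)) ^ 2 / 2) := by
      intro j
      have h2 : 0 < √(2 * Real.pi) := by positivity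
      have h3 := (Real.rpow_pos_of_pos h2 (‖p j‖ ^ 2)).ne'
      have h4 := (Real.rpow_pos_of_pos (hn j) (‖p j‖ ^ 2)).ne'
      simp only [hθ]
      rw [Real.div_rpow (by positivity) (hn j).le, Real.mul_rpow h2.le (Real.exp_pos _).le,
        ← Real.exp_mul]
      have h5 : Real.exp (-⟪p j, z⟫) =
          Real.exp ((-t j z + T (t j z) ^ 2 / 2) * ‖p j‖ ^ 2) *
          Real.exp (-(‖p j‖ * T (t j z)) ^ 2 / 2) := by
        rw [← Real.exp_add]
        congr 1
        have := (hn j).ne'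
        simp only [ht]
        field_simp
        ring
      rw [h5]
      field_simp
    have hsum : Real.exp (-∑ j, ⟪p j, z⟫) = K * ((∏ j, θ z j ^ (‖p j‖ ^ 2)) *
        Real.exp (-(∑ j, (‖p j‖ * T (t j z)) ^ 2) / 2)) := by
      rw [← Finset.sum_neg_distrib, Real.exp_sum, Finset.prod_congr rfl fun j _ => hfac j,
        Finset.prod_mul_distrib, Finset.prod_mul_distrib, Finset.prod_mul_distrib,
        Finset.prod_inv_distrib, ← Real.rpow_sum_of_pos (by positivity),
        sum_norm_sq_eq_finrank_of_parseval hp, Real.rpow_natCast, ← Real.exp_sum,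
        ← Finset.sum_div, Finset.sum_neg_distrib]
      ring
    rw [hsum]
    refine mul_le_mul_of_nonneg_left ?_ hK0
    refine mul_le_mul (hdet.trans (le_abs_self _)) (Real.exp_le_exp.2 ?_) (Real.exp_pos _).le
      (abs_nonneg _)
    have : ‖Φ z‖ ^ 2 ≤ ∑ j, (‖p j‖ * T (t j z)) ^ 2 := hnorm
    linarith
  calc ∫⁻ z in U, ENNReal.ofReal (Real.exp (-∑ j, ⟪p j, z⟫))
      ≤ ∫⁻ z in U, ENNReal.ofReal K *
          (ENNReal.ofReal |(Φ' z).det| * ENNReal.ofReal (Real.exp (-‖Φ z‖ ^ 2 / 2))) := by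
        refine setLIntegral_mono' hUm fun z hz => ?_
        rw [← ENNReal.ofReal_mul (abs_nonneg _), ← ENNReal.ofReal_mul hK0]
        exact ENNReal.ofReal_le_ofReal (hpt z hz)
    _ = ENNReal.ofReal K * ∫⁻ y in Φ '' U, ENNReal.ofReal (Real.exp (-‖y‖ ^ 2 / 2)) := by
        rw [lintegral_const_mul' _ _ ENNReal.ofReal_ne_top,
          lintegral_image_eq_lintegral_abs_det_fderiv_mul volume hUm hderiv hinj]
    -- Only an upper bound is needed, so `Φ` need not be onto.
    _ ≤ ENNReal.ofReal K * ∫⁻ y : F, ENNReal.ofReal (Real.exp (-‖y‖ ^ 2 / 2)) := by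
        gcongr
        exact Measure.restrict_le_self
    _ = ENNReal.ofReal (∏ j, ‖p j‖ ^ (‖p j‖ ^ 2)) := by
        rw [lintegral_exp_neg_half_norm_sq, ← ENNReal.ofReal_mul hK0, hK,
          inv_mul_cancel_right₀ (by positivity)]

end ParsevalFrame

/-! ### Exponential integrals over cones -/

theorem lintegral_Ioi_pow_mul_exp_neg (d : ℕ) :
    ∫⁻ s in Set.Ioi (0 : ℝ), ENNReal.ofReal (s ^ d) * ENNReal.ofReal (Real.exp (-s)) =
      ENNReal.ofReal (d.factorial : ℝ) := by
  have hd : (0 : ℝ) < d + 1 := by positivity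
  rw [← Real.Gamma_nat_eq_factorial, Real.Gamma_eq_integral hd,
    ofReal_integral_eq_lintegral_ofReal (Real.GammaIntegral_convergent hd)]
  · refine setLIntegral_congr_fun measurableSet_Ioi fun s hs => ?_
    rw [← ENNReal.ofReal_mul (pow_nonneg (le_of_lt hs) d), add_sub_cancel_right,
      Real.rpow_natCast, mul_comm]
  · refine (ae_restrict_iff' measurableSet_Ioi).2 (Filter.Eventually.of_forall fun s hs => ?_)
    exact mul_nonneg (Real.exp_pos _).le (Real.rpow_nonneg (le_of_lt hs) _)

section Cone

variable {F : Type*} [NormedAddCommGroup F] [InnerProductSpace ℝ F] [FiniteDimensional ℝ F]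
  [MeasurableSpace F] [BorelSpace F]

open scoped Pointwise in
/-- The integral of an exponential over a cone, in terms of the volume of the section of the cone
at height one. -/
theorem lintegral_exp_neg_inner_cone {w : F} (hw : w ≠ 0) {C : Set F} (hC : MeasurableSet C)
    (hsmul : ∀ r : ℝ, 0 < r → ∀ x ∈ C, r • x ∈ C) (hnn : ∀ x ∈ C, 0 ≤ ⟪w, x⟫) :
    ∫⁻ x in C, ENNReal.ofReal (Real.exp (-⟪w, x⟫)) =
      (μHE[Module.finrank ℝ F - 1] : Measure F) (C ∩ {x | ⟪w, x⟫ = 1}) *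
        ENNReal.ofReal ((Module.finrank ℝ F - 1).factorial / ‖w‖) := by
  set d := Module.finrank ℝ F - 1 with hd
  set A := (μHE[d] : Measure F) (C ∩ {x | ⟪w, x⟫ = 1}) with hA
  have hwn : 0 < ‖w‖ := norm_pos_iff.2 hw
  -- Since `⟪w, v⟫ = 1`, the slices along `v` are indexed by the value of `⟪w, x⟫`; the slicing
  -- formula contributes the factor `‖v‖ = 1 / ‖w‖`.
  set v : F := (‖w‖ ^ 2)⁻¹ • w with hv
  have hv0 : v ≠ 0 := smul_ne_zero (by positivity) hw
  have hwv : ⟪w, v⟫ = 1 := by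
    rw [hv, real_inner_smul_right, real_inner_self_eq_norm_sq]
    field_simp
  have hvn : ‖v‖ₑ = ENNReal.ofReal ‖w‖⁻¹ := by
    rw [← ofReal_norm, hv, norm_smul, norm_inv, norm_pow, norm_norm]
    congr 1
    field_simp
  have hslice : ∀ s : ℝ,
      (AffineSubspace.mk' (s • v +ᵥ (0 : F)) (Submodule.span ℝ {v})ᗮ : Set F) =
        {x | ⟪w, x⟫ = s} := by
    intro s
    ext x
    rw [SetLike.mem_coe, AffineSubspace.mem_mk', Submodule.mem_orthogonal_singleton_iff_inner_right]
    simp only [vadd_eq_add, add_zero, vsub_eq_sub, Set.mem_ofPred_eq]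
    rw [hv, real_inner_smul_left, ← hv, inner_sub_right, real_inner_smul_right, hwv]
    have : (‖w‖ ^ 2)⁻¹ ≠ 0 := by positivity
    rw [mul_eq_zero, or_iff_right this, mul_one, sub_eq_zero]
  have hscale : ∀ s : ℝ, 0 < s → (μHE[d] : Measure F) (C ∩ {x | ⟪w, x⟫ = s}) =
      ENNReal.ofReal (s ^ d) * A := by
    intro s hs
    have : C ∩ {x | ⟪w, x⟫ = s} = s • (C ∩ {x | ⟪w, x⟫ = 1}) := by
      ext x
      rw [Set.mem_smul_set_iff_inv_smul_mem₀ hs.ne']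
      simp only [Set.mem_inter_iff, Set.mem_ofPred_eq, real_inner_smul_right]
      refine and_congr ⟨fun h => hsmul _ (inv_pos.2 hs) _ h, fun h => ?_⟩ ?_
      · simpa [smul_smul, hs.ne'] using hsmul s hs _ h
      · rw [inv_mul_eq_one₀ hs.ne', eq_comm]
    rw [this, Measure.euclideanHausdorffMeasure_smul₀ d hs.ne', ENNReal.smul_def, smul_eq_mul,
      ENNReal.coe_pow, ← enorm_eq_nnnorm, ← ofReal_norm, Real.norm_of_nonneg hs.le,
      ENNReal.ofReal_pow hs.le]
  set f : ℝ → ENNReal := fun s => (Set.Ioi (0 : ℝ)).indicator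
    (fun s => ENNReal.ofReal ‖w‖⁻¹ * (ENNReal.ofReal (s ^ d) * A)) s with hf
  have hfm : Measurable f := Measurable.indicator (by fun_prop) measurableSet_Ioi
  have hlm : Measurable fun x : F => ⟪w, x⟫ := by fun_prop
  have hmap : (volume.restrict C).map (fun x => ⟪w, x⟫) = volume.withDensity f := by
    ext B hB
    rw [Measure.map_apply hlm hB, Measure.restrict_apply (hlm hB), withDensity_apply _ hB,
      ← InnerProductSpace.euclideanHausdorffMeasure_eq_volume,
      EuclideanGeometry.euclideanHausdorffMeasure_eq_lintegral (0 : F) hv0 ((hlm hB).inter hC),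
      ← lintegral_const_mul' _ _ (by simp), ← lintegral_indicator hB]
    refine lintegral_congr_ae ?_
    -- Homogeneity says nothing about the slice at height `0`, which is a single null value of `s`.
    have h0 : ∀ᵐ s : ℝ, s ≠ 0 := by simp [ae_iff]
    filter_upwards [h0] with s hs
    rw [hslice, hvn, ← hd]
    by_cases hsB : s ∈ B
    · have h1 : (fun x => ⟪w, x⟫) ⁻¹' B ∩ C ∩ {x | ⟪w, x⟫ = s} = C ∩ {x | ⟪w, x⟫ = s} := by
        ext x
        simp only [Set.mem_inter_iff, Set.mem_preimage, Set.mem_ofPred_eq]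
        constructor
        · tauto
        · rintro ⟨h2, rfl⟩; exact ⟨⟨hsB, h2⟩, rfl⟩
      rw [h1, Set.indicator_of_mem hsB]
      rcases lt_or_gt_of_ne hs with h | h
      · have h2 : C ∩ {x | ⟪w, x⟫ = s} = ∅ := by
          refine Set.eq_empty_of_forall_notMem fun x hx => ?_
          have h3 := hnn x hx.1
          rw [hx.2] at h3
          exact h3.not_gt h
        rw [h2, measure_empty, mul_zero, hf]
        simp [h.le]
      · rw [hscale s h, hf]
        simp [h]
    · have h1 : (fun x => ⟪w, x⟫) ⁻¹' B ∩ C ∩ {x | ⟪w, x⟫ = s} = ∅ := by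
        refine Set.eq_empty_of_forall_notMem fun x hx => hsB ?_
        have := hx.1.1
        rwa [Set.mem_preimage, hx.2] at this
      rw [h1, measure_empty, mul_zero, Set.indicator_of_notMem hsB]
  have hem : Measurable fun s : ℝ => ENNReal.ofReal (Real.exp (-s)) := by fun_prop
  calc ∫⁻ x in C, ENNReal.ofReal (Real.exp (-⟪w, x⟫))
      = ∫⁻ s, ENNReal.ofReal (Real.exp (-s)) ∂((volume.restrict C).map fun x => ⟪w, x⟫) :=
        (lintegral_map hem hlm).symm
    _ = ∫⁻ s, f s * ENNReal.ofReal (Real.exp (-s)) := by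
        rw [hmap, lintegral_withDensity_eq_lintegral_mul _ hfm hem]
        rfl
    _ = ∫⁻ s in Set.Ioi (0 : ℝ), (ENNReal.ofReal ‖w‖⁻¹ * A) *
          (ENNReal.ofReal (s ^ d) * ENNReal.ofReal (Real.exp (-s))) := by
        rw [← lintegral_indicator measurableSet_Ioi]
        refine lintegral_congr fun s => ?_
        by_cases hs : s ∈ Set.Ioi (0 : ℝ)
        · rw [hf]
          simp only [Set.indicator_of_mem hs]
          ring
        · rw [hf]
          simp only [Set.indicator_of_notMem hs, zero_mul]
    _ = A * ENNReal.ofReal (d.factorial / ‖w‖) := by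
        rw [lintegral_const_mul _ (by fun_prop), lintegral_Ioi_pow_mul_exp_neg, div_eq_mul_inv,
          ENNReal.ofReal_mul (by positivity)]
        ring

end Cone

/-! ### The extremal problem for `∑ c log c` -/

/-- A convex function of two variables with fixed sum grows when the variables are spread. -/
theorem ConvexOn.add_le_add_of_spread {s : Set ℝ} {f : ℝ → ℝ} (hf : ConvexOn ℝ s f)
    {u v x y : ℝ} (hu : u ∈ s) (hv : v ∈ s) (hsum : x + y = u + v) (hx : u ≤ x) (hy : u ≤ y) :
    f x + f y ≤ f u + f v := by
  rcases (show u ≤ v by linarith).eq_or_lt with h | h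
  · have h1 : x = u := by linarith
    have h2 : y = v := by linarith
    rw [h1, h2]
  · have hd : 0 < v - u := sub_pos.2 h
    have key : ∀ z, u ≤ z → z ≤ v →
        f z ≤ (v - z) / (v - u) * f u + (z - u) / (v - u) * f v := by
      intro z h1 h2
      have h3 := hf.2 hu hv (div_nonneg (sub_nonneg.2 h2) hd.le)
        (div_nonneg (sub_nonneg.2 h1) hd.le) (by field_simp; ring)
      have h4 : ((v - z) / (v - u)) • u + ((z - u) / (v - u)) • v = z := by
        simp only [smul_eq_mul]; field_simp; ring
      rw [h4] at h3
      simpa using h3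
    have h1 := key x hx (by linarith)
    have h2 := key y hy (by linarith)
    have h3 : (v - x) / (v - u) * f u + (x - u) / (v - u) * f v +
        ((v - y) / (v - u) * f u + (y - u) / (v - u) * f v) = f u + f v := by
      have : y = u + v - x := by linarith
      subst this
      field_simp
      ring
    linarith

/-- A sum of values of a convex function on `[a, b]` is at most the value of a configuration with
the same sum in which all variables but one are at the end points. -/
theorem ConvexOn.exists_sum_le_extreme {ι : Type*} {f : ℝ → ℝ} {a b : ℝ}
    (hf : ConvexOn ℝ (Set.Icc a b) f) (hab : a ≤ b) (s : Finset ι) (c : ι → ℝ)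
    (hc : ∀ j ∈ s, c j ∈ Set.Icc a b) (hs : s.Nonempty) :
    ∃ p q : ℕ, ∃ t ∈ Set.Icc a b, p + q + 1 = s.card ∧
      ∑ j ∈ s, c j = p * b + q * a + t ∧ ∑ j ∈ s, f (c j) ≤ p * f b + q * f a + f t := by
  classical
  induction hs using Finset.Nonempty.cons_induction with
  | singleton i => exact ⟨0, 0, c i, hc i (by simp), by simp, by simp, by simp⟩
  | cons i s hi hs ih =>
    obtain ⟨p, q, t, ht, hcard, hsum, hle⟩ := ih fun j hj => hc j (Finset.mem_cons_of_mem hj)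
    have hci := hc i (Finset.mem_cons_self i s)
    -- Spread the free variable and the new one at constant sum until one reaches an end point: `a`
    -- if the sum is at most `a + b`, otherwise `b`.
    rcases le_total (t + c i) (a + b) with h | h
    · refine ⟨p, q + 1, t + c i - a, ⟨by linarith [ht.1, hci.1], by linarith⟩, ?_, ?_, ?_⟩
      · rw [Finset.card_cons]; omega
      · rw [Finset.sum_cons, hsum]; push_cast; ring
      · have := hf.add_le_add_of_spread (u := a) (v := t + c i - a) (x := t) (y := c i)
          ⟨le_rfl, hab⟩ ⟨by linarith [ht.1, hci.1], by linarith⟩ (by ring) ht.1 hci.1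
        rw [Finset.sum_cons]; push_cast; linarith
    · refine ⟨p + 1, q, t + c i - b, ⟨by linarith, by linarith [ht.2, hci.2]⟩, ?_, ?_, ?_⟩
      · rw [Finset.card_cons]; omega
      · rw [Finset.sum_cons, hsum]; push_cast; ring
      · have := hf.add_le_add_of_spread (u := t + c i - b) (v := b) (x := t) (y := c i)
          ⟨by linarith, by linarith [ht.2, hci.2]⟩ ⟨hab, le_rfl⟩ (by ring) (by linarith [hci.2])
          (by linarith [ht.2])
        rw [Finset.sum_cons]; push_cast; linarith

/-- By convexity all entries but one may be moved to `1/N` or `1`. Integrality of `k` then leaves `k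
- 1` entries `1`, `N - k` entries `1/N` and one entry `k/N`. -/
theorem sum_mul_log_le_of_inv_card_le {ι : Type*} [Fintype ι] [Nonempty ι] {k : ℕ} (hk : 1 ≤ k)
    {c : ι → ℝ} (hc : ∀ j, (Fintype.card ι : ℝ)⁻¹ ≤ c j) (hc1 : ∀ j, c j ≤ 1)
    (hsum : ∑ j, c j = k) :
    ∑ j, c j * Real.log (c j) ≤
      k / Fintype.card ι * Real.log k - Real.log (Fintype.card ι) := by
  set N := Fintype.card ι with hN
  have hN1 : 1 ≤ N := Fintype.card_pos
  have hNpos : (0 : ℝ) < N := by exact_mod_cast hN1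
  have hconv : ConvexOn ℝ (Set.Icc ((N : ℝ)⁻¹) 1) fun x => x * Real.log x :=
    Real.convexOn_mul_log.subset (fun x hx => (inv_nonneg.2 hNpos.le).trans hx.1)
      (convex_Icc _ _)
  obtain ⟨p, q, t, ⟨ht0, ht1⟩, hcard, hs, hle⟩ := hconv.exists_sum_le_extreme
    (inv_le_one_of_one_le₀ (by exact_mod_cast hN1)) Finset.univ c
    (fun j _ => ⟨hc j, hc1 j⟩) Finset.univ_nonempty
  rw [Finset.card_univ, ← hN] at hcard
  rw [hsum, mul_one, ← div_eq_mul_inv] at hs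
  have ht0' : 1 ≤ N * t := by rwa [inv_le_iff_one_le_mul₀' hNpos] at ht0
  have ht1' : N * t ≤ N := by nlinarith
  have hs' : (k : ℝ) * N = p * N + q + N * t := by
    rw [hs]; field_simp
  have hlo : p * N + q + 1 ≤ k * N := by
    have : (p : ℝ) * N + q + 1 ≤ k * N := by linarith
    exact_mod_cast this
  have hhi : k * N ≤ p * N + q + N := by
    have : (k : ℝ) * N ≤ p * N + q + N := by linarith
    exact_mod_cast this
  -- Since `q < N`, the two bounds place `k * N` strictly between `p * N` and `(p + 2) * N`.
  have hpk : p + 1 = k := by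
    rcases lt_trichotomy (p + 1) k with h | h | h
    · have : (p + 2) * N ≤ k * N := Nat.mul_le_mul_right _ h
      nlinarith
    · exact h
    · have : k * N ≤ p * N := Nat.mul_le_mul_right _ (by omega)
      omega
  have hq : (q : ℝ) = N - k := by
    have : q + k = N := by omega
    rw [← this]; push_cast; ring
  have hp : (p : ℝ) = k - 1 := by rw [← hpk]; push_cast; ring
  have hk0 : (0 : ℝ) < k := by exact_mod_cast hk
  have ht : t = k / N := by
    rw [hp, hq] at hs'
    field_simp
    linarith
  refine hle.trans (le_of_eq ?_)
  rw [ht, hq, Real.log_one, Real.log_inv, Real.log_div hk0.ne' hNpos.ne']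
  field_simp
  ring

/-- Here the chord of `x log x` over `[1/m, 1]` suffices: it is affine, so summing it uses only `∑ c
j = k`. For `m = 1` the interval is a point. -/
theorem sum_mul_log_le_of_inv_le {ι : Type*} [Fintype ι] {k m : ℕ} (hm : 1 ≤ m)
    (hkm : k + m = Fintype.card ι + 1) {c : ι → ℝ} (hc : ∀ j, (m : ℝ)⁻¹ ≤ c j)
    (hc1 : ∀ j, c j ≤ 1) (hsum : ∑ j, c j = k) :
    ∑ j, c j * Real.log (c j) ≤ -Real.log m := by
  have hm0 : (0 : ℝ) < m := by exact_mod_cast hm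
  rcases hm.eq_or_lt with h | h
  · subst h
    have : ∀ j, c j = 1 := fun j => le_antisymm (hc1 j) (by simpa using hc j)
    simp [this]
  · have h1 : (1 : ℝ) < m := by exact_mod_cast h
    have hm1 : (0 : ℝ) < m - 1 := by linarith
    have key : ∀ j, c j * Real.log (c j) ≤ (1 - c j) / (m - 1) * -Real.log m := by
      intro j
      have hcm : 0 ≤ m * c j - 1 := by
        have := mul_le_mul_of_nonneg_left (hc j) hm0.le
        rw [mul_inv_cancel₀ hm0.ne'] at this
        linarith
      have h2 := Real.convexOn_mul_log.2
        (show (m : ℝ)⁻¹ ∈ Set.Ici 0 from inv_nonneg.2 hm0.le)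
        (show (1 : ℝ) ∈ Set.Ici 0 from Set.mem_Ici.2 zero_le_one)
        (div_nonneg (mul_nonneg hm0.le (sub_nonneg.2 (hc1 j))) hm1.le)
        (div_nonneg hcm hm1.le) (by field_simp; ring)
      have h3 : (m * (1 - c j) / (m - 1)) • (m : ℝ)⁻¹ + ((m * c j - 1) / (m - 1)) • (1 : ℝ) =
          c j := by
        simp only [smul_eq_mul]; field_simp; ring
      rw [h3] at h2
      refine h2.trans (le_of_eq ?_)
      simp only [smul_eq_mul, Real.log_one, Real.log_inv]
      field_simp
      ring
    have hN : (Fintype.card ι : ℝ) = k + m - 1 := by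
      have : (k : ℝ) + m = Fintype.card ι + 1 := by exact_mod_cast hkm
      linarith
    calc ∑ j, c j * Real.log (c j) ≤ ∑ j, (1 - c j) / (m - 1) * -Real.log m :=
          Finset.sum_le_sum fun j _ => key j
      _ = -Real.log m := by
          rw [← Finset.sum_mul, ← Finset.sum_div, Finset.sum_sub_distrib, hsum]
          simp only [Finset.sum_const, Finset.card_univ, nsmul_eq_mul, mul_one, hN]
          rw [show (k : ℝ) + m - 1 - k = m - 1 by ring, div_self hm1.ne', one_mul]

/-! ### Central sections of the simplex -/

theorem simplexCentroid_apply (n : ℕ) (j : Fin (n + 1)) :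
    simplexCentroid n j = ((n : ℝ) + 1)⁻¹ := by
  rw [simplexCentroid, Finset.centroid_def,
    Finset.affineCombination_eq_linear_combination _ _ _
      (Finset.sum_centroidWeights_eq_one_of_nonempty ℝ _ Finset.univ_nonempty)]
  simp [Finset.centroidWeights_apply, Finset.sum_apply, Pi.single_apply]

/-- The two cones differ by subsets of finitely many hyperplanes. The simplex yields the closed
cone, while transport works on the open one. -/
theorem setLIntegral_closed_orthant_eq_open {ι F : Type*} [Fintype ι] [NormedAddCommGroup F]
    [InnerProductSpace ℝ F] [FiniteDimensional ℝ F] [MeasurableSpace F] [BorelSpace F]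
    {p : ι → F} (hp0 : ∀ j, p j ≠ 0) (g : F → ENNReal) :
    ∫⁻ z in {z | ∀ j, 0 ≤ ⟪p j, z⟫}, g z = ∫⁻ z in {z | ∀ j, 0 < ⟪p j, z⟫}, g z := by
  refine setLIntegral_congr ?_
  have hne : ∀ᵐ z : F, ∀ j, ⟪p j, z⟫ ≠ 0 := by
    rw [ae_all_iff]
    intro j
    have h : (volume : Measure F) (LinearMap.ker (innerₛₗ ℝ (p j)) : Set F) = 0 := by
      refine Measure.addHaar_submodule _ _ fun h => hp0 j ?_
      have : p j ∈ LinearMap.ker (innerₛₗ ℝ (p j)) := h ▸ Submodule.mem_top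
      simpa using this
    rw [ae_iff]
    refine measure_mono_null (fun z hz => ?_) h
    simpa using hz
  filter_upwards [hne] with z hz
  refine propext (forall_congr' fun j => ?_)
  exact ⟨fun h => lt_of_le_of_ne h (hz j).symm, le_of_lt⟩

section Section

variable {n : ℕ} {F : Type*} [NormedAddCommGroup F] [InnerProductSpace ℝ F]
  [FiniteDimensional ℝ F]

/-- The squared distance of a vertex to a subspace is bounded below in terms of the length of its
projection. -/
theorem one_sub_norm_adjoint_sq_le_infDist_sq (J : F →ₗᵢ[ℝ] EuclideanSpace ℝ (Fin (n + 1)))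
    (j : Fin (n + 1)) :
    1 - ‖J.toContinuousLinearMap.adjoint (EuclideanSpace.single j (1 : ℝ))‖ ^ 2 ≤
      Metric.infDist (EuclideanSpace.single j (1 : ℝ)) (Set.range J) ^ 2 := by
  set p := J.toContinuousLinearMap.adjoint (EuclideanSpace.single j (1 : ℝ)) with hp
  refine (Real.sqrt_le_left Metric.infDist_nonneg).1 ?_
  rw [Metric.le_infDist (Set.range_nonempty J)]
  rintro _ ⟨z, rfl⟩
  refine Real.sqrt_le_iff.2 ⟨dist_nonneg, ?_⟩
  have h1 : ⟪EuclideanSpace.single j (1 : ℝ), J z⟫ = ⟪p, z⟫ := by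
    rw [hp, ContinuousLinearMap.adjoint_inner_left]; rfl
  rw [dist_eq_norm, norm_sub_sq_real, h1, J.norm_map]
  -- The squared distance from the vertex to `J z` equals `1 - ‖p‖ ^ 2 + ‖p - z‖ ^ 2`.
  have h2 := norm_sub_sq_real p z
  have h3 := sq_nonneg ‖p - z‖
  simp only [PiLp.norm_single, norm_one, one_pow]
  linarith

variable [MeasurableSpace F] [BorelSpace F]

/-- The volume of a central section of the simplex as an exponential integral over a cone. -/
theorem kVol_section_mul_eq_lintegral (J : F →ₗᵢ[ℝ] EuclideanSpace ℝ (Fin (n + 1)))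
    (hJ : simplexCentroid n ∈ Set.range J) :
    kVol (Module.finrank ℝ F - 1) (Set.range J ∩ regularSimplex n) *
        ENNReal.ofReal ((Module.finrank ℝ F - 1).factorial / √((n : ℝ) + 1)) =
      ∫⁻ z in {z | ∀ j, 0 ≤ J z j}, ENNReal.ofReal (Real.exp (-∑ j, J z j)) := by
  obtain ⟨z₀, hz₀⟩ := hJ
  have hn : (0 : ℝ) < n + 1 := by positivity
  -- `J w` is the all-ones vector, so `w` represents the coordinate sum on `F`.
  set w : F := ((n : ℝ) + 1) • z₀ with hw
  have hJw : ∀ j, J w j = 1 := fun j => by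
    rw [hw, map_smul, hz₀, PiLp.smul_apply, simplexCentroid_apply, smul_eq_mul,
      mul_inv_cancel₀ hn.ne']
  have hwz : ∀ z, ⟪w, z⟫ = ∑ j, J z j := fun z => by
    rw [← J.inner_map_map, PiLp.inner_apply]
    simp [hJw]
  have hwn : ‖w‖ = √((n : ℝ) + 1) := by
    rw [← J.norm_map, EuclideanSpace.norm_eq]
    simp [hJw]
  have hw0 : w ≠ 0 := norm_pos_iff.1 (by rw [hwn]; positivity)
  set C : Set F := {z | ∀ j, 0 ≤ J z j} with hC
  have hCm : MeasurableSet C := by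
    have : C = ⋂ j, {z | 0 ≤ J z j} := by ext; simp [hC]
    rw [this]
    have hc := J.continuous
    exact (isClosed_iInter fun j => isClosed_le continuous_const (by fun_prop)).measurableSet
  have hcone := lintegral_exp_neg_inner_cone hw0 hCm
    (fun r hr z hz j => by
      rw [map_smul, PiLp.smul_apply, smul_eq_mul]
      exact mul_nonneg hr.le (hz j))
    (fun z hz => by rw [hwz]; exact Finset.sum_nonneg fun j _ => hz j)
  have himg : Set.range J ∩ regularSimplex n = J '' (C ∩ {z | ⟪w, z⟫ = 1}) := by
    ext x
    constructor
    · rintro ⟨⟨z, rfl⟩, h1, h2⟩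
      exact ⟨z, ⟨h2, by rw [Set.mem_ofPred_eq, hwz, h1]⟩, rfl⟩
    · rintro ⟨z, ⟨h2, h1⟩, rfl⟩
      exact ⟨⟨z, rfl⟩, by rw [← hwz]; exact h1, h2⟩
  rw [kVol, himg, J.isometry.euclideanHausdorffMeasure_image, ← hwn, ← hcone]
  simp only [hwz]

/-- The volume of a central section of the simplex is controlled by the projections of the
vertices. -/
theorem kVol_section_le (J : F →ₗᵢ[ℝ] EuclideanSpace ℝ (Fin (n + 1)))
    (hJ : simplexCentroid n ∈ Set.range J) {X : ℝ} (hX : 0 < X)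
    (hle : ∀ c : Fin (n + 1) → ℝ, (∀ j, ((n : ℝ) + 1)⁻¹ ≤ c j) → (∀ j, c j ≤ 1) →
      ∑ j, c j = Module.finrank ℝ F →
      (∀ j, 1 - c j ≤ Metric.infDist (EuclideanSpace.single j (1 : ℝ)) (Set.range J) ^ 2) →
      ∑ j, c j * Real.log (c j) ≤ 2 * Real.log X) :
    kVol (Module.finrank ℝ F - 1) (Set.range J ∩ regularSimplex n) ≤
      ENNReal.ofReal (√((n : ℝ) + 1) / (Module.finrank ℝ F - 1).factorial * X) := by
  have hn : (0 : ℝ) < n + 1 := by positivity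
  set p : Fin (n + 1) → F :=
    fun j => J.toContinuousLinearMap.adjoint (EuclideanSpace.single j (1 : ℝ)) with hp
  have hpz : ∀ j z, ⟪p j, z⟫ = J z j := fun j z => by
    rw [hp, ContinuousLinearMap.adjoint_inner_left, EuclideanSpace.inner_single_left]
    simp
  have hpars : ∀ z, ∑ j, ⟪p j, z⟫ ^ 2 = ‖z‖ ^ 2 := fun z => by
    simp only [hpz]
    rw [← J.norm_map, EuclideanSpace.norm_sq_eq]
    simp
  -- Cauchy–Schwarz against the preimage of the centroid, for which `⟪p j, z₀⟫ = ‖z₀‖ ^ 2 =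
  -- 1/(n+1)`.
  have hlow : ∀ j, ((n : ℝ) + 1)⁻¹ ≤ ‖p j‖ ^ 2 := by
    intro j
    obtain ⟨z₀, hz₀⟩ := hJ
    have h1 : ⟪p j, z₀⟫ = ((n : ℝ) + 1)⁻¹ := by rw [hpz, hz₀, simplexCentroid_apply]
    have h2 : ‖z₀‖ ^ 2 = ((n : ℝ) + 1)⁻¹ := by
      rw [← hpars]
      simp only [hpz, hz₀, simplexCentroid_apply]
      simp
      field_simp
    have h3 := real_inner_mul_inner_self_le (p j) z₀
    rw [h1, real_inner_self_eq_norm_sq, real_inner_self_eq_norm_sq, h2] at h3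
    exact le_of_mul_le_mul_right h3 (inv_pos.2 hn)
  have hpos : ∀ j, 0 < ‖p j‖ := fun j => by
    have := (inv_pos.2 hn).trans_le (hlow j)
    exact lt_of_le_of_ne (norm_nonneg _) fun h => by rw [← h] at this; simp at this
  have hp0 : ∀ j, p j ≠ 0 := fun j => norm_pos_iff.1 (hpos j)
  have hup : ∀ j, ‖p j‖ ^ 2 ≤ 1 := by
    intro j
    have h1 : ⟪p j, p j⟫ ^ 2 ≤ ‖p j‖ ^ 2 := by
      rw [← hpars (p j)]
      exact Finset.single_le_sum (f := fun i => ⟪p i, p j⟫ ^ 2) (fun i _ => sq_nonneg _)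
        (Finset.mem_univ j)
    rw [real_inner_self_eq_norm_sq] at h1
    have h2 := pow_pos (hpos j) 2
    nlinarith
  have hlog := hle (fun j => ‖p j‖ ^ 2) hlow hup (sum_norm_sq_eq_finrank_of_parseval hpars)
    fun j => one_sub_norm_adjoint_sq_le_infDist_sq J j
  have hprod : ∏ j, ‖p j‖ ^ (‖p j‖ ^ 2) ≤ X := by
    have h1 : ∏ j, ‖p j‖ ^ (‖p j‖ ^ 2) =
        Real.exp (∑ j, ‖p j‖ ^ 2 * Real.log (‖p j‖ ^ 2) / 2) := by
      rw [Real.exp_sum]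
      refine Finset.prod_congr rfl fun j _ => ?_
      rw [Real.rpow_def_of_pos (hpos j), Real.log_pow]
      congr 1
      push_cast
      ring
    rw [h1, ← Finset.sum_div, ← Real.le_log_iff_exp_le hX]
    linarith
  have hvol := kVol_section_mul_eq_lintegral J hJ
  have hBL := (lintegral_exp_neg_sum_inner_le_of_parseval hpars hp0).trans
    (ENNReal.ofReal_le_ofReal hprod)
  rw [← setLIntegral_closed_orthant_eq_open hp0] at hBL
  simp only [hpz] at hBL
  rw [← hvol] at hBL
  have hf : (0 : ℝ) < (Module.finrank ℝ F - 1).factorial / √((n : ℝ) + 1) := by positivity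
  rw [← ENNReal.le_div_iff_mul_le (Or.inl (by simpa using hf)) (Or.inl ENNReal.ofReal_ne_top),
    ← ENNReal.ofReal_div_of_pos hf] at hBL
  refine hBL.trans (le_of_eq ?_)
  congr 1
  field_simp

end Section

/-! ### The extremal subspaces -/

theorem lintegral_exp_neg_sum_mul_orthant {κ : Type*} [Fintype κ] {b : κ → ℝ}
    (hb : ∀ i, 0 < b i) :
    ∫⁻ z : EuclideanSpace ℝ κ in {z | ∀ i, 0 ≤ z i},
        ENNReal.ofReal (Real.exp (-∑ i, b i * z i)) = ENNReal.ofReal (∏ i, (b i)⁻¹) := by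
  set g : κ → ℝ → ℝ := fun i => (Set.Ici (0 : ℝ)).indicator fun s => Real.exp (-(b i * s)) with hg
  have hm : MeasurableSet {z : EuclideanSpace ℝ κ | ∀ i, 0 ≤ z i} := by
    have : {z : EuclideanSpace ℝ κ | ∀ i, 0 ≤ z i} = ⋂ i, {z | 0 ≤ z i} := by ext; simp
    rw [this]
    exact (isClosed_iInter fun i => isClosed_le continuous_const (by fun_prop)).measurableSet
  have h1 : ∀ z : EuclideanSpace ℝ κ, Set.indicator {z : EuclideanSpace ℝ κ | ∀ i, 0 ≤ z i}
      (fun z => ENNReal.ofReal (Real.exp (-∑ i, b i * z i))) z =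
      ENNReal.ofReal (∏ i, g i (WithLp.ofLp z i)) := by
    intro z
    by_cases hz : ∀ i, 0 ≤ z i
    · rw [Set.indicator_of_mem (by exact hz), ← Finset.sum_neg_distrib, Real.exp_sum]
      congr 1
      refine Finset.prod_congr rfl fun i _ => ?_
      rw [hg]
      exact (Set.indicator_of_mem (Set.mem_Ici.2 (hz i)) fun s => Real.exp (-(b i * s))).symm
    · rw [Set.indicator_of_notMem (by exact hz)]
      push Not at hz
      obtain ⟨i, hi⟩ := hz
      rw [Finset.prod_eq_zero (Finset.mem_univ i), ENNReal.ofReal_zero]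
      exact Set.indicator_of_notMem (not_le.2 hi) _
  have h2 : ∀ i, ∫ s, g i s = (b i)⁻¹ := by
    intro i
    rw [hg, integral_indicator measurableSet_Ici, integral_Ici_eq_integral_Ioi]
    have := integral_exp_mul_Ioi (neg_lt_zero.2 (hb i)) 0
    simp only [neg_mul] at this
    rw [this]
    simp
  have hval : ∫ x : κ → ℝ, ∏ i, g i (x i) = ∏ i, (b i)⁻¹ := by
    rw [integral_fintype_prod_volume_eq_prod]
    exact Finset.prod_congr rfl fun i _ => h2 i
  have hnn : ∀ x : κ → ℝ, 0 ≤ ∏ i, g i (x i) := fun x =>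
    Finset.prod_nonneg fun i _ => Set.indicator_nonneg (fun s _ => (Real.exp_pos _).le) _
  rw [← lintegral_indicator hm]
  simp_rw [h1]
  rw [(PiLp.volume_preserving_ofLp κ).lintegral_comp_emb
      (MeasurableEquiv.toLp 2 (κ → ℝ)).symm.measurableEmbedding
      (fun x : κ → ℝ => ENNReal.ofReal (∏ i, g i (x i))), ← hval,
    ofReal_integral_eq_lintegral_ofReal]
  · refine Integrable.of_integral_ne_zero ?_
    rw [hval]
    exact Finset.prod_ne_zero_iff.2 fun i _ => (inv_pos.2 (hb i)).ne'
  · exact Filter.Eventually.of_forall hnn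

section Fibers

variable {ι κ : Type*} [Fintype ι] [DecidableEq κ]

/-- The number of elements of a fiber, as a real number. -/
noncomputable def fiberCard (f : ι → κ) (i : κ) : ℝ :=
  ((Finset.univ.filter fun j => f j = i).card : ℝ)

theorem fiberCard_pos {f : ι → κ} (hf : Function.Surjective f) (i : κ) : 0 < fiberCard f i := by
  obtain ⟨j, hj⟩ := hf i
  exact Nat.cast_pos.2 (Finset.card_pos.2 ⟨j, by simp [hj]⟩)

variable [Fintype κ]

theorem sum_comp_eq_sum_fiberCard_mul (f : ι → κ) (h : κ → ℝ) :
    ∑ j, h (f j) = ∑ i, fiberCard f i * h i := by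
  rw [← Finset.sum_fiberwise' Finset.univ f h]
  simp [fiberCard]

/-- The isometric embedding whose range consists of the vectors that are constant on the fibers
of a surjection. -/
noncomputable def fiberIsometry {f : ι → κ} (hf : Function.Surjective f) :
    EuclideanSpace ℝ κ →ₗᵢ[ℝ] EuclideanSpace ℝ ι where
  toFun z := WithLp.toLp 2 fun j => z (f j) / √(fiberCard f (f j))
  map_add' x y := by ext j; simp [add_div]
  map_smul' r x := by ext j; simp [mul_div_assoc]
  norm_map' z := by
    rw [← sq_eq_sq₀ (norm_nonneg _) (norm_nonneg _), EuclideanSpace.norm_sq_eq,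
      EuclideanSpace.norm_sq_eq]
    simp only [LinearMap.coe_mk, AddHom.coe_mk, Real.norm_eq_abs, sq_abs, div_pow]
    rw [sum_comp_eq_sum_fiberCard_mul f fun i => z i ^ 2 / √(fiberCard f i) ^ 2]
    refine Finset.sum_congr rfl fun i _ => ?_
    have := fiberCard_pos hf i
    rw [Real.sq_sqrt this.le]
    field_simp

@[simp]
theorem fiberIsometry_apply {f : ι → κ} (hf : Function.Surjective f) (z : EuclideanSpace ℝ κ)
    (j : ι) : fiberIsometry hf z j = z (f j) / √(fiberCard f (f j)) := rfl

/-- Surjectivity makes the cone the full orthant, and the coordinate sum becomes `∑ √(fiberCard f i)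
* z i`, so the integral factorises. -/
theorem lintegral_fiberIsometry {f : ι → κ} (hf : Function.Surjective f) :
    ∫⁻ z in {z | ∀ j, 0 ≤ fiberIsometry hf z j},
        ENNReal.ofReal (Real.exp (-∑ j, fiberIsometry hf z j)) =
      ENNReal.ofReal (∏ i, (√(fiberCard f i))⁻¹) := by
  have hs : ∀ i, 0 < √(fiberCard f i) := fun i => Real.sqrt_pos.2 (fiberCard_pos hf i)
  rw [← lintegral_exp_neg_sum_mul_orthant hs]
  have hset : {z | ∀ j, 0 ≤ fiberIsometry hf z j} = {z : EuclideanSpace ℝ κ | ∀ i, 0 ≤ z i} := by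
    ext z
    constructor
    · intro h i
      obtain ⟨j, rfl⟩ := hf i
      have h1 := h j
      rw [fiberIsometry_apply] at h1
      have h2 := mul_nonneg h1 (hs (f j)).le
      rwa [div_mul_cancel₀ _ (hs (f j)).ne'] at h2
    · intro h j
      exact div_nonneg (h (f j)) (hs (f j)).le
  rw [hset]
  refine lintegral_congr fun z => ?_
  congr 3
  simp only [fiberIsometry_apply]
  rw [sum_comp_eq_sum_fiberCard_mul f fun i => z i / √(fiberCard f i)]
  refine Finset.sum_congr rfl fun i _ => ?_
  rw [mul_div_left_comm, Real.div_sqrt, mul_comm]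

theorem infDist_single_range_fiberIsometry_sq_le [DecidableEq ι] {f : ι → κ}
    (hf : Function.Surjective f) (j : ι) :
    Metric.infDist (EuclideanSpace.single j (1 : ℝ)) (Set.range (fiberIsometry hf)) ^ 2 ≤
      1 - (fiberCard f (f j))⁻¹ := by
  have ha := fiberCard_pos hf (f j)
  -- The coordinates of the orthogonal projection of the vertex.
  set z : EuclideanSpace ℝ κ := EuclideanSpace.single (f j) (√(fiberCard f (f j)))⁻¹ with hz
  have h1 := Metric.infDist_le_dist_of_mem (x := EuclideanSpace.single j (1 : ℝ))
    (Set.mem_range_self (f := fiberIsometry hf) z)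
  refine (pow_le_pow_left₀ Metric.infDist_nonneg h1 2).trans (le_of_eq ?_)
  rw [dist_eq_norm, norm_sub_sq_real, (fiberIsometry hf).norm_map,
    EuclideanSpace.inner_single_left, fiberIsometry_apply, hz]
  simp only [PiLp.norm_single, norm_one, one_pow, map_one, one_mul, norm_inv, inv_pow,
    Real.norm_eq_abs, sq_abs, PiLp.single_apply, if_true]
  rw [Real.sq_sqrt ha.le, div_eq_mul_inv, ← mul_inv, Real.mul_self_sqrt ha.le]
  ring

end Fibers

theorem simplexCentroid_mem_range_fiberIsometry {n : ℕ} {κ : Type*} [Fintype κ] [DecidableEq κ]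
    {f : Fin (n + 1) → κ} (hf : Function.Surjective f) :
    simplexCentroid n ∈ Set.range (fiberIsometry hf) := by
  refine ⟨WithLp.toLp 2 fun i => √(fiberCard f i) * ((n : ℝ) + 1)⁻¹, ?_⟩
  ext j
  rw [fiberIsometry_apply, simplexCentroid_apply]
  have := Real.sqrt_pos.2 (fiberCard_pos hf (f j))
  field_simp

/-- A surjection onto `Fin (d + 1)` with one fiber of the given size and all others singletons. -/
theorem exists_surjective_fiberCard {n d : ℕ} (hd : d ≤ n) :
    ∃ f : Fin (n + 1) → Fin (d + 1), Function.Surjective f ∧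
      (∀ i : Fin d, fiberCard f i.castSucc = 1) ∧
      fiberCard f (Fin.last d) = (n : ℝ) + 1 - d := by
  -- Truncation at `d` merges exactly the indices `d, …, n`.
  refine ⟨fun j => ⟨min j d, by omega⟩, ?_, ?_, ?_⟩
  · intro i
    exact ⟨⟨i, by omega⟩, Fin.ext (by simp; omega)⟩
  · intro i
    have : (Finset.univ.filter fun j : Fin (n + 1) =>
        (⟨min j d, by omega⟩ : Fin (d + 1)) = i.castSucc) = {⟨i, by omega⟩} := by
      ext j
      simp only [Finset.mem_filter, Finset.mem_univ, true_and, Finset.mem_singleton, Fin.ext_iff,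
        Fin.val_castSucc]
      omega
    simp [fiberCard, this]
  · have : (Finset.univ.filter fun j : Fin (n + 1) =>
        (⟨min j d, by omega⟩ : Fin (d + 1)) = Fin.last d) = Finset.Ici ⟨d, by omega⟩ := by
      ext j
      simp only [Finset.mem_filter, Finset.mem_univ, true_and, Fin.ext_iff, Fin.val_last,
        Finset.mem_Ici, Fin.le_def]
      omega
    rw [fiberCard, this, Fin.card_Ici, Nat.cast_sub (by simp; omega)]
    push_cast
    ring

/-! ### The two bounds and sharpness -/

theorem theorem4 (n k : ℕ) (hk : 1 ≤ k) (hkn : k ≤ n + 1) :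
    -- the bound for every `k`-dimensional subspace through the centroid
    (∀ H : Submodule ℝ (EuclideanSpace ℝ (Fin (n + 1))),
      Module.finrank ℝ H = k → simplexCentroid n ∈ H →
        kVol (k - 1) ((H : Set (EuclideanSpace ℝ (Fin (n + 1)))) ∩ regularSimplex n) ≤
          ENNReal.ofReal (√((n : ℝ) + 1) / (Nat.factorial (k - 1) : ℝ) *
            ((√(k : ℝ)) ^ ((k : ℝ) / ((n : ℝ) + 1)) / √((n : ℝ) + 1)))) ∧
    -- the bound under the additional distance condition
    (∀ H : Submodule ℝ (EuclideanSpace ℝ (Fin (n + 1))),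
      Module.finrank ℝ H = k → simplexCentroid n ∈ H →
      (∀ j : Fin (n + 1),
        Metric.infDist (EuclideanSpace.single j (1 : ℝ))
            (H : Set (EuclideanSpace ℝ (Fin (n + 1)))) ^ 2 ≤
          ((n : ℝ) + 1 - k) / ((n : ℝ) + 2 - k)) →
        kVol (k - 1) ((H : Set (EuclideanSpace ℝ (Fin (n + 1)))) ∩ regularSimplex n) ≤
          ENNReal.ofReal (√((n : ℝ) + 1) / (Nat.factorial (k - 1) : ℝ) *
            (1 / √((n : ℝ) + 2 - k)))) ∧
    -- sharpness of the second bound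
    (∃ H : Submodule ℝ (EuclideanSpace ℝ (Fin (n + 1))),
      Module.finrank ℝ H = k ∧ simplexCentroid n ∈ H ∧
      (∀ j : Fin (n + 1),
        Metric.infDist (EuclideanSpace.single j (1 : ℝ))
            (H : Set (EuclideanSpace ℝ (Fin (n + 1)))) ^ 2 ≤
          ((n : ℝ) + 1 - k) / ((n : ℝ) + 2 - k)) ∧
        kVol (k - 1) ((H : Set (EuclideanSpace ℝ (Fin (n + 1)))) ∩ regularSimplex n) =
          ENNReal.ofReal (√((n : ℝ) + 1) / (Nat.factorial (k - 1) : ℝ) *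
            (1 / √((n : ℝ) + 2 - k)))) := by
  have hn : (0 : ℝ) < n + 1 := by positivity
  have hk0 : (0 : ℝ) < k := by exact_mod_cast hk
  have hkn' : (k : ℝ) ≤ n + 1 := by exact_mod_cast hkn
  have hm : (0 : ℝ) < n + 2 - k := by linarith
  refine ⟨?_, ?_, ?_⟩
  · intro H hH hc
    have hr : Set.range H.subtypeₗᵢ = (H : Set (EuclideanSpace ℝ (Fin (n + 1)))) := by simp
    have hs : 0 < √(k : ℝ) := Real.sqrt_pos.2 hk0
    have h := kVol_section_le H.subtypeₗᵢ (by rwa [hr])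
      (X := √(k : ℝ) ^ ((k : ℝ) / ((n : ℝ) + 1)) / √((n : ℝ) + 1)) (by positivity)
      fun c h1 h2 h3 _ => by
        rw [hH] at h3
        have h4 := sum_mul_log_le_of_inv_card_le hk
          (by simpa only [Fintype.card_fin, Nat.cast_add, Nat.cast_one] using h1) h2 h3
        rw [Fintype.card_fin] at h4
        push_cast at h4
        refine h4.trans (le_of_eq ?_)
        rw [Real.log_div (by positivity) (by positivity), Real.log_rpow hs,
          Real.log_sqrt hk0.le, Real.log_sqrt hn.le]
        ring
    rwa [hH, hr] at h
  · intro H hH hc hdist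
    have hr : Set.range H.subtypeₗᵢ = (H : Set (EuclideanSpace ℝ (Fin (n + 1)))) := by simp
    have h := kVol_section_le H.subtypeₗᵢ (by rwa [hr])
      (X := 1 / √((n : ℝ) + 2 - k)) (by positivity)
      fun c _ h2 h3 h4 => by
        rw [hH] at h3
        have hcast : ((n + 2 - k : ℕ) : ℝ) = (n : ℝ) + 2 - k := by
          rw [Nat.cast_sub (by omega)]; push_cast; ring
        have h5 := sum_mul_log_le_of_inv_le (k := k) (m := n + 2 - k) (by omega)
          (by rw [Fintype.card_fin]; omega)
          (fun j => by
            have h6 := h4 j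
            rw [hr] at h6
            replace h6 := h6.trans (hdist j)
            -- With `m = n + 2 - k` the distance condition reads `dist² ≤ 1 - 1/m`, which gives `c j
            -- ≥ 1/m`.
            have h7 : ((n : ℝ) + 1 - k) / (n + 2 - k) = 1 - (n + 2 - k : ℝ)⁻¹ := by
              rw [eq_sub_iff_add_eq, ← one_div, ← add_div, div_eq_one_iff_eq hm.ne']; ring
            rw [h7] at h6
            rw [hcast]
            linarith) h2 h3
        rw [hcast] at h5
        refine h5.trans (le_of_eq ?_)
        rw [one_div, Real.log_inv, Real.log_sqrt hm.le]
        ring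
    rwa [hH, hr] at h
  · obtain ⟨d, rfl⟩ : ∃ d, k = d + 1 := ⟨k - 1, by omega⟩
    obtain ⟨f, hf, hf1, hf2⟩ := exists_surjective_fiberCard (show d ≤ n by omega)
    have hcast : (n : ℝ) + 2 - ((d + 1 : ℕ) : ℝ) = (n : ℝ) + 1 - d := by push_cast; ring
    have hcast' : (n : ℝ) + 1 - ((d + 1 : ℕ) : ℝ) = (n : ℝ) - d := by push_cast; ring
    have hdn : (d : ℝ) ≤ n := by exact_mod_cast (show d ≤ n by omega)
    have hm' : (0 : ℝ) < n + 1 - d := by linarith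
    set J := fiberIsometry hf with hJ
    have hr : ((LinearMap.range J.toLinearMap : Submodule ℝ _) :
        Set (EuclideanSpace ℝ (Fin (n + 1)))) = Set.range J := by
      rw [LinearMap.coe_range]; rfl
    have hle : ∀ i, fiberCard f i ≤ (n : ℝ) + 1 - d := by
      intro i
      refine Fin.lastCases hf2.le (fun i => ?_) i
      rw [hf1]; linarith
    refine ⟨LinearMap.range J.toLinearMap, ?_, ?_, ?_, ?_⟩
    · rw [LinearMap.finrank_range_of_inj J.injective, finrank_euclideanSpace_fin]
    · exact simplexCentroid_mem_range_fiberIsometry hf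
    · intro j
      rw [hr, hcast, hcast']
      refine (infDist_single_range_fiberIsometry_sq_le hf j).trans ?_
      have h1 := inv_anti₀ (fiberCard_pos hf (f j)) (hle (f j))
      have h2 : ((n : ℝ) - d) / (n + 1 - d) = 1 - (n + 1 - d : ℝ)⁻¹ := by
        rw [eq_sub_iff_add_eq, ← one_div, ← add_div, div_eq_one_iff_eq hm'.ne']; ring
      rw [h2]
      linarith
    -- The cone integral is computed exactly here; only the large fiber, of size `n + 1 - d = n + 2
    -- - k`, contributes a factor other than `1`.
    · have h := kVol_section_mul_eq_lintegral J (simplexCentroid_mem_range_fiberIsometry hf)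
      rw [hJ, lintegral_fiberIsometry hf, ← hJ, finrank_euclideanSpace_fin,
        Fin.prod_univ_castSucc] at h
      simp only [hf1, hf2, Real.sqrt_one, inv_one, Finset.prod_const_one, one_mul] at h
      have hfac : (0 : ℝ) < (d + 1 - 1).factorial / √((n : ℝ) + 1) := by positivity
      rw [mul_comm, ← ENNReal.eq_div_iff (by simpa using hfac) ENNReal.ofReal_ne_top,
        ← ENNReal.ofReal_div_of_pos hfac] at h
      rw [hr, hcast, h]
      congr 1
      field_simp
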